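/- Let $X$ be a real Banach space with property $(\mathcal{D}')$, that is, every $w^*$-sequentially closed subspace of the dual $X^*$ is $w^*$-closed. Let $(\Omega,\Sigma,\nu)$ be a complete probability space, and let $\Gamma\subseteq X^*$ be a (not necessarily closed) linear subspace that is total over $X$, i.e. for every $x\in X\setminus\{0\}$ there is $x^*\in\Gamma$ with $x^*(x)\neq 0$. A function $f:\Omega\to X$ is called $\Gamma$-integrable if $\langle x^*,f\rangle$ is $\nu$-integrable for every $x^*\in\Gamma$ and, for every $A\in\Sigma$, there is an element $\int_A f\,d\nu\in X$ such that $$x^*\Big(\int_A f\,d\nu\Big)=\int_A\langle x^*,f\rangle\,d\nu\quad\text{for all }x^*\in\Gamma .$$ It is called Pettis integrable if it is $X^*$-integrable, i.e. if this holds with $\Gamma=X^*$. Then every $\Gamma$-integrable function $f:\Omega\to X$ is Pettis integrable. -/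

import Mathlib

open MeasureTheory

/-- Property (D'): every weak-star sequentially closed subspace of the dual `X*` is weak-star closed.
Norm-closedness of the subspace is not required separately, since it follows from weak-star
sequential closedness. -/
def PropertyDPrime (X : Type*) [NormedAddCommGroup X] [NormedSpace ℝ X] : Prop :=
  ∀ S : Submodule ℝ (WeakDual ℝ X),
    IsSeqClosed (S : Set (WeakDual ℝ X)) → IsClosed (S : Set (WeakDual ℝ X))

/-- A set of functionals is total if it separates the points of `X`. -/
def IsTotalSet {X : Type*} [NormedAddCommGroup X] [NormedSpace ℝ X]
    (D : Set (StrongDual ℝ X)) : Prop :=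
  ∀ x : X, x ≠ 0 → ∃ φ ∈ D, φ x ≠ 0

/-- `f` is `Γ`-scalarly integrable: `⟨φ, f⟩` is integrable for all `φ ∈ Γ`. -/
def IsScalarlyIntegrable {X Ω : Type*} [NormedAddCommGroup X] [NormedSpace ℝ X]
    [MeasurableSpace Ω] (Γ : Submodule ℝ (StrongDual ℝ X)) (f : Ω → X) (ν : Measure Ω) : Prop :=
  ∀ φ ∈ Γ, Integrable (fun ω => φ (f ω)) ν

/-- `f` is `Γ`-integrable: it is `Γ`-scalarly integrable, and for every measurable `A` there is an
element `y` of `X` (the integral of `f` over `A`) with `φ y = ∫_A ⟨φ, f⟩ dν` for all `φ ∈ Γ`. -/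
def IsGammaIntegrable {X Ω : Type*} [NormedAddCommGroup X] [NormedSpace ℝ X]
    [MeasurableSpace Ω] (Γ : Submodule ℝ (StrongDual ℝ X)) (f : Ω → X) (ν : Measure Ω) : Prop :=
  IsScalarlyIntegrable Γ f ν ∧
    ∀ A : Set Ω, MeasurableSet A → ∃ y : X, ∀ φ ∈ Γ, φ y = ∫ ω in A, φ (f ω) ∂ν

/-- Pettis integrability is `Γ`-integrability for `Γ = X*`. -/
def IsPettisIntegrable {X Ω : Type*} [NormedAddCommGroup X] [NormedSpace ℝ X]
    [MeasurableSpace Ω] (f : Ω → X) (ν : Measure Ω) : Prop :=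
  IsGammaIntegrable (⊤ : Submodule ℝ (StrongDual ℝ X)) f ν

/-!
Fix a choice `y A` of the integral of `f` over each measurable set `A`, and let `S` be the subspace
of all functionals `φ` such that `⟨φ, f⟩` is integrable and `φ (y A) = ∫_A ⟨φ, f⟩ dν` for every `A`
(`integralSubspace`). It contains `Γ`, and `f` is Pettis integrable as soon as `S` is the whole dual.

The point is that `S` is weak-star sequentially closed (`isSeqClosed_integralSubspace`). If `φₙ ∈ S`
converges weak-star to `φ`, then `⟨φₙ, f⟩ → ⟨φ, f⟩` pointwise, and for each `A` the integrals
`∫_A ⟨φₙ, f⟩ dν = φₙ (y A)` converge to `φ (y A)`. By the Vitali–Hahn–Saks theorem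
(`unifIntegrable_of_cauchySeq_setIntegral`), setwise convergence makes the functions `⟨φₙ, f⟩`
uniformly integrable, so Vitali's convergence theorem gives convergence in `L¹(ν)`
(`integrable_and_tendsto_setIntegral_of_cauchySeq`), and the limit relation
`φ (y A) = ∫_A ⟨φ, f⟩ dν` follows. The Vitali–Hahn–Saks theorem itself comes from Baire's theorem
on the measure algebra of `ν`, viewed as a closed subset of `L¹(ν)`
(`exists_abs_setIntegral_sub_le`).

Property (D') now says that `S` is weak-star closed, and it contains a total subspace, so it is
everything by the Hahn–Banach theorem (`WeakDual.eq_top_of_isClosed_of_isTotalSet`).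
-/

open Filter Topology
open scoped ENNReal

/-! ### The Vitali–Hahn–Saks theorem -/

namespace MeasureTheory

variable {Ω : Type*} [MeasurableSpace Ω] {ν : Measure Ω}

variable (ν) in
/-- The measure algebra of `ν`, realised inside `L¹(ν)` as the set of classes of functions with
values in `{0, 1}`. Unlike `MeasuredSets ν`, it comes with completeness, being closed in `L¹(ν)`. -/
def indicatorsLp : Set (Lp ℝ 1 ν) := {h | ∀ᵐ ω ∂ν, h ω ∈ ({0, 1} : Set ℝ)}

theorem isClosed_indicatorsLp : IsClosed (indicatorsLp ν) := by
  refine IsSeqClosed.isClosed fun h h₀ hh hlim => ?_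
  obtain ⟨φ, -, hφ⟩ := (tendstoInMeasure_of_tendsto_Lp hlim).exists_seq_tendsto_ae
  have hall : ∀ᵐ ω ∂ν, ∀ n, h n ω ∈ ({0, 1} : Set ℝ) := ae_all_iff.2 hh
  filter_upwards [hall, hφ] with ω h1 h2
  exact (Set.toFinite ({0, 1} : Set ℝ)).isClosed.mem_of_tendsto h2
    (Eventually.of_forall fun i => h1 (φ i))

/-- Integration against a fixed integrable function is continuous on the measure algebra, by
dominated convergence along almost everywhere convergent subsequences. -/
theorem continuous_integral_mul_indicatorsLp {u : Ω → ℝ} (hu : Integrable u ν) :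
    Continuous fun h : indicatorsLp ν => ∫ ω, (h : Lp ℝ 1 ν) ω * u ω ∂ν := by
  refine continuous_iff_seqContinuous.2 fun h h₀ hlim => tendsto_of_subseq_tendsto fun ns hns => ?_
  have hlim' : Tendsto (fun k => (h (ns k) : Lp ℝ 1 ν)) atTop (𝓝 (h₀ : Lp ℝ 1 ν)) :=
    ((continuous_subtype_val.tendsto h₀).comp hlim).comp hns
  obtain ⟨φ, -, hφ⟩ := (tendstoInMeasure_of_tendsto_Lp hlim').exists_seq_tendsto_ae
  refine ⟨φ, tendsto_integral_of_dominated_convergence (fun ω => ‖u ω‖)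
    (fun k => (Lp.aestronglyMeasurable _).mul hu.1) hu.norm (fun k => ?_) ?_⟩
  · filter_upwards [(h (ns (φ k))).2] with ω hω
    rcases hω with hω | hω
    · simp [hω]
    · have hω : (h (ns (φ k)) : Lp ℝ 1 ν) ω = 1 := hω
      simp [hω]
  · filter_upwards [hφ] with ω hω
    exact hω.mul_const _

theorem indicatorConstLp_mem_indicatorsLp [IsFiniteMeasure ν] {A : Set Ω} (hA : MeasurableSet A) :
    indicatorConstLp 1 hA (measure_ne_top ν A) (1 : ℝ) ∈ indicatorsLp ν := by
  filter_upwards [indicatorConstLp_coeFn (p := 1) (hs := hA) (hμs := measure_ne_top ν A)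
    (c := (1 : ℝ))] with ω hω
  by_cases h : ω ∈ A <;> simp [hω, h]

theorem integral_indicatorConstLp_mul [IsFiniteMeasure ν] {A : Set Ω} (hA : MeasurableSet A)
    (u : Ω → ℝ) :
    ∫ ω, indicatorConstLp 1 hA (measure_ne_top ν A) (1 : ℝ) ω * u ω ∂ν = ∫ ω in A, u ω ∂ν := by
  rw [← integral_indicator hA]
  refine integral_congr_ae ?_
  filter_upwards [indicatorConstLp_coeFn (p := 1) (hs := hA) (hμs := measure_ne_top ν A)
    (c := (1 : ℝ))] with ω hω
  by_cases h : ω ∈ A <;> simp [hω, h]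

theorem exists_eq_indicatorConstLp [IsFiniteMeasure ν] {h : Lp ℝ 1 ν} (hh : h ∈ indicatorsLp ν) :
    ∃ (A : Set Ω) (hA : MeasurableSet A),
      h = indicatorConstLp 1 hA (measure_ne_top ν A) (1 : ℝ) := by
  have hA : MeasurableSet {ω | h ω = 1} :=
    (Lp.stronglyMeasurable h).measurable (measurableSet_singleton 1)
  refine ⟨_, hA, Lp.ext ?_⟩
  filter_upwards [hh, indicatorConstLp_coeFn (p := 1) (hs := hA)
    (hμs := measure_ne_top ν _) (c := (1 : ℝ))] with ω h1 h2
  rw [h2]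
  rcases h1 with h1 | h1
  · simp [h1]
  · have h1 : h ω = 1 := h1
    simp [h1]

/-- Baire's theorem on the measure algebra: if `∫_A gₙ` is a Cauchy sequence for each measurable
`A`, then it is Cauchy uniformly over all sets `A` of small measure. -/
theorem exists_abs_setIntegral_sub_le [IsFiniteMeasure ν] {g : ℕ → Ω → ℝ}
    (hg : ∀ n, Integrable (g n) ν)
    (hc : ∀ A, MeasurableSet A → CauchySeq fun n => ∫ ω in A, g n ω ∂ν) {ε : ℝ} (hε : 0 < ε) :
    ∃ r > 0, ∃ N, ∀ B, MeasurableSet B → ν.real B < r → ∀ m ≥ N, ∀ n ≥ N,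
      |∫ ω in B, (g m ω - g n ω) ∂ν| ≤ ε := by
  have hint : ∀ m n, Integrable (fun ω => g m ω - g n ω) ν := fun m n => (hg m).sub (hg n)
  let F : ℕ → Set (indicatorsLp ν) := fun N =>
    {h | ∀ m ≥ N, ∀ n ≥ N, |∫ ω, (h : Lp ℝ 1 ν) ω * (g m ω - g n ω) ∂ν| ≤ ε / 2}
  have hFc : ∀ N, IsClosed (F N) := fun N => by
    simp only [F, Set.ofPred_forall]
    exact isClosed_iInter fun m => isClosed_iInter fun _ => isClosed_iInter fun n =>
      isClosed_iInter fun _ => isClosed_le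
        (continuous_integral_mul_indicatorsLp (hint m n)).abs continuous_const
  have hFU : ⋃ N, F N = Set.univ := by
    refine Set.eq_univ_of_forall fun ⟨h, hh⟩ => ?_
    obtain ⟨A, hA, rfl⟩ := exists_eq_indicatorConstLp hh
    obtain ⟨N, hN⟩ := Metric.cauchySeq_iff.1 (hc A hA) (ε / 2) (half_pos hε)
    refine Set.mem_iUnion.2 ⟨N, fun m hm n hn => ?_⟩
    rw [integral_indicatorConstLp_mul hA,
      integral_sub (hg m).integrableOn (hg n).integrableOn, ← Real.dist_eq]
    exact (hN m hm n hn).le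
  have : CompleteSpace (indicatorsLp ν) := isClosed_indicatorsLp.completeSpace_coe
  have : Nonempty (indicatorsLp ν) := ⟨_, indicatorConstLp_mem_indicatorsLp MeasurableSet.empty⟩
  obtain ⟨N, h₀, hh₀⟩ := nonempty_interior_of_iUnion_of_closed hFc hFU
  obtain ⟨r, hr, hball⟩ := Metric.mem_nhds_iff.1 (mem_interior_iff_mem_nhds.1 hh₀)
  obtain ⟨A, hA, hA₀⟩ := exists_eq_indicatorConstLp h₀.2
  refine ⟨r, hr, N, fun B hB hBr m hm n hn => ?_⟩
  -- Every set that differs from the centre `A` of the ball only inside `B` lies in the ball.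
  have key : ∀ C, MeasurableSet C → symmDiff C A ⊆ B →
      |∫ ω in C, (g m ω - g n ω) ∂ν| ≤ ε / 2 := by
    intro C hC hCA
    have hmem : (⟨_, indicatorConstLp_mem_indicatorsLp (ν := ν) hC⟩ : indicatorsLp ν) ∈ F N := by
      refine hball ?_
      rw [Metric.mem_ball, Subtype.dist_eq, hA₀, dist_indicatorConstLp_eq_norm,
        norm_indicatorConstLp one_ne_zero ENNReal.one_ne_top]
      simpa using (measureReal_mono hCA).trans_lt hBr
    have := hmem m hm n hn
    rwa [integral_indicatorConstLp_mul hC] at this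
  have h1 := key (A ∪ B) (hA.union hB) (by
    intro x hx; simp only [Set.mem_symmDiff, Set.mem_union] at hx; tauto)
  have h2 := key (A \ B) (hA.diff hB) (by
    intro x hx; simp only [Set.mem_symmDiff, Set.mem_sdiff] at hx; tauto)
  have h3 : ∫ ω in A ∪ B, (g m ω - g n ω) ∂ν =
      ∫ ω in A \ B, (g m ω - g n ω) ∂ν + ∫ ω in B, (g m ω - g n ω) ∂ν := by
    rw [← Set.sdiff_union_self, setIntegral_union Set.disjoint_sdiff_left hB
      (hint m n).integrableOn (hint m n).integrableOn]
  rw [show ∫ ω in B, (g m ω - g n ω) ∂ν = ∫ ω in A ∪ B, (g m ω - g n ω) ∂ν -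
    ∫ ω in A \ B, (g m ω - g n ω) ∂ν by rw [h3]; ring]
  exact (abs_sub _ _).trans (by linarith)

/-- Bounding `u` in `L¹(B)` by its integrals over subsets of `B`, via the sets where `u` is
nonnegative and where it is negative. -/
theorem eLpNorm_indicator_le_of_abs_setIntegral_le {u : Ω → ℝ} (hu : Integrable u ν)
    {B : Set Ω} (hB : MeasurableSet B) {ε : ℝ}
    (h : ∀ C, MeasurableSet C → C ⊆ B → |∫ ω in C, u ω ∂ν| ≤ ε) :
    eLpNorm (B.indicator u) 1 ν ≤ ENNReal.ofReal (2 * ε) := by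
  -- A measurable representative is needed to split `B` according to the sign of `u`.
  obtain ⟨v, hv, huv⟩ := hu.1
  have hvi : Integrable v ν := hu.congr huv
  have h' : ∀ C, MeasurableSet C → C ⊆ B → |∫ ω in C, v ω ∂ν| ≤ ε := fun C hC hCB => by
    rw [← integral_congr_ae (ae_restrict_of_ae huv)]
    exact h C hC hCB
  have hP : MeasurableSet {ω | 0 ≤ v ω} := measurableSet_le measurable_const hv.measurable
  rw [eLpNorm_congr_ae (g := B.indicator v) (huv.mono fun ω hω => by
      by_cases hB : ω ∈ B <;> simp [hB, hω]), eLpNorm_indicator_eq_eLpNorm_restrict hB,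
    eLpNorm_one_eq_lintegral_enorm, ← ofReal_integral_norm_eq_lintegral_enorm hvi.integrableOn]
  refine ENNReal.ofReal_le_ofReal ?_
  rw [← integral_inter_add_sdiff hP hvi.norm.integrableOn]
  have h1 : ∫ ω in B ∩ {ω | 0 ≤ v ω}, ‖v ω‖ ∂ν = ∫ ω in B ∩ {ω | 0 ≤ v ω}, v ω ∂ν :=
    setIntegral_congr_fun (hB.inter hP) fun ω hω => abs_of_nonneg hω.2
  have h2 : ∫ ω in B \ {ω | 0 ≤ v ω}, ‖v ω‖ ∂ν = - ∫ ω in B \ {ω | 0 ≤ v ω}, v ω ∂ν := by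
    rw [← integral_neg]
    exact setIntegral_congr_fun (hB.diff hP) fun ω hω => abs_of_neg (not_le.1 hω.2)
  rw [h1, h2]
  have h3 := (abs_le.1 (h' _ (hB.inter hP) Set.inter_subset_left)).2
  have h4 := (abs_le.1 (h' _ (hB.diff hP) Set.sdiff_subset)).1
  linarith

/-- **Vitali–Hahn–Saks theorem** for sequences of densities: setwise convergence of the indefinite
integrals forces uniform integrability. -/
theorem unifIntegrable_of_cauchySeq_setIntegral [IsFiniteMeasure ν] {g : ℕ → Ω → ℝ}
    (hg : ∀ n, Integrable (g n) ν)
    (hc : ∀ A, MeasurableSet A → CauchySeq fun n => ∫ ω in A, g n ω ∂ν) :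
    UnifIntegrable g 1 ν := by
  intro ε hε
  obtain ⟨r, hr, N, hN⟩ := exists_abs_setIntegral_sub_le hg hc (by positivity : 0 < ε / 4)
  -- The finitely many functions with index at most `N` are handled separately.
  obtain ⟨δ, hδ, hfin⟩ := unifIntegrable_finite le_rfl ENNReal.one_ne_top
    (f := fun i : Fin (N + 1) => g i) (fun i => memLp_one_iff_integrable.2 (hg i)) (half_pos hε)
  refine ⟨min δ (r / 2), by positivity, fun n B hB hBδ => ?_⟩
  have hB1 : ν B ≤ ENNReal.ofReal δ := hBδ.trans (ENNReal.ofReal_le_ofReal (min_le_left _ _))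
  have hB2 : ν.real B < r := by
    have := ENNReal.toReal_le_of_le_ofReal (by positivity) hBδ
    exact (this.trans (min_le_right _ _)).trans_lt (by linarith)
  rcases lt_or_ge n N with hn | hn
  · exact (hfin ⟨n, by omega⟩ B hB hB1).trans (ENNReal.ofReal_le_ofReal (by linarith))
  have h1 : eLpNorm (B.indicator fun ω => g n ω - g N ω) 1 ν ≤ ENNReal.ofReal (2 * (ε / 4)) :=
    eLpNorm_indicator_le_of_abs_setIntegral_le ((hg n).sub (hg N)) hB fun C hC hCB =>
      hN C hC ((measureReal_mono hCB).trans_lt hB2) n hn N le_rfl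
  have h2 := hfin ⟨N, by omega⟩ B hB hB1
  have h3 : B.indicator (g n) = (B.indicator fun ω => g n ω - g N ω) + B.indicator (g N) := by
    rw [← Set.indicator_add']
    congr 1
    ext ω
    simp
  rw [h3]
  calc _ ≤ _ := eLpNorm_add_le (((hg n).sub (hg N)).1.indicator hB) ((hg N).1.indicator hB) le_rfl
    _ ≤ ENNReal.ofReal (2 * (ε / 4)) + ENNReal.ofReal (ε / 2) := add_le_add h1 h2
    _ = ENNReal.ofReal ε := by
      rw [← ENNReal.ofReal_add (by positivity) (by positivity)]
      congr 1
      ring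

/-- Setwise convergence of the indefinite integrals upgrades almost everywhere convergence to
convergence in `L¹`. -/
theorem integrable_and_tendsto_setIntegral_of_cauchySeq [IsFiniteMeasure ν] {g : ℕ → Ω → ℝ}
    {g₀ : Ω → ℝ} (hg : ∀ n, Integrable (g n) ν)
    (hc : ∀ A, MeasurableSet A → CauchySeq fun n => ∫ ω in A, g n ω ∂ν)
    (hlim : ∀ᵐ ω ∂ν, Tendsto (fun n => g n ω) atTop (𝓝 (g₀ ω))) :
    Integrable g₀ ν ∧
      ∀ A, Tendsto (fun n => ∫ ω in A, g n ω ∂ν) atTop (𝓝 (∫ ω in A, g₀ ω ∂ν)) := by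
  have hui := unifIntegrable_of_cauchySeq_setIntegral hg hc
  -- Vitali's theorem is applied to differences, whose limit `0` is known to be integrable;
  -- uniform integrability in the measure-theoretic sense gives no norm bound when `ν` has atoms.
  have hcau : ∀ ε : ℝ≥0∞, 0 < ε → ∃ N, ∀ m ≥ N, ∀ n ≥ N, eLpNorm (g m - g n) 1 ν ≤ ε := by
    by_contra! hcon
    obtain ⟨ε, hε, hcon⟩ := hcon
    choose m hm n hn hmn using hcon
    have hm' : Tendsto m atTop atTop := tendsto_atTop_mono hm tendsto_id
    have hn' : Tendsto n atTop atTop := tendsto_atTop_mono hn tendsto_id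
    have huim : UnifIntegrable (fun k => g (m k)) 1 ν := fun ε hε =>
      let ⟨δ, hδ, h⟩ := hui hε
      ⟨δ, hδ, fun k => h (m k)⟩
    have huin : UnifIntegrable (fun k => g (n k)) 1 ν := fun ε hε =>
      let ⟨δ, hδ, h⟩ := hui hε
      ⟨δ, hδ, fun k => h (n k)⟩
    have h0 := tendsto_Lp_finite_of_tendsto_ae (g := 0) le_rfl ENNReal.one_ne_top
      (fun k => (hg (m k)).1.sub (hg (n k)).1) MemLp.zero
      (huim.sub huin le_rfl (fun k => (hg (m k)).1) (fun k => (hg (n k)).1)) (by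
        filter_upwards [hlim] with ω hω
        simpa using (hω.comp hm').sub (hω.comp hn'))
    obtain ⟨k, hk⟩ := (h0.eventually (gt_mem_nhds hε)).exists
    exact (hmn k).not_gt (by simpa using hk)
  have hlimN : ∀ ε : ℝ≥0∞, 0 < ε → ∃ N, ∀ n ≥ N, eLpNorm (g n - g₀) 1 ν ≤ ε := fun ε hε => by
    obtain ⟨N, hN⟩ := hcau ε hε
    refine ⟨N, fun n hn => Lp.eLpNorm_le_of_ae_tendsto (u := atTop) (f := fun k => g n - g k)
      (eventually_atTop.2 ⟨N, fun k hk => hN n hn k hk⟩) (fun k => (hg n).1.sub (hg k).1) ?_⟩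
    filter_upwards [hlim] with ω hω
    exact hω.const_sub _
  have hint : Integrable g₀ ν := by
    obtain ⟨N, hN⟩ := hlimN 1 one_pos
    have h1 : MemLp (g N - g₀) 1 ν :=
      ⟨(hg N).1.sub (aestronglyMeasurable_of_tendsto_ae atTop (fun n => (hg n).1) hlim),
        (hN N le_rfl).trans_lt ENNReal.one_lt_top⟩
    have h2 := (hg N).sub (memLp_one_iff_integrable.1 h1)
    rwa [sub_sub_cancel] at h2
  refine ⟨hint, tendsto_setIntegral_of_L1' _ hint.1 (Eventually.of_forall hg) ?_⟩
  exact ENNReal.tendsto_atTop_zero.2 hlimN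

end MeasureTheory

/-! ### Total subspaces of the dual -/

/-- A total subspace is weak-star dense: by Hahn–Banach a point outside a weak-star closed subspace
is separated from it by a weak-star continuous functional, that is, by a vector of `X`. -/
theorem WeakDual.eq_top_of_isClosed_of_isTotalSet {X : Type*} [NormedAddCommGroup X]
    [NormedSpace ℝ X] {S : Submodule ℝ (WeakDual ℝ X)} (hS : IsClosed (S : Set (WeakDual ℝ X)))
    (hT : IsTotalSet (WeakDual.toStrongDual '' (S : Set (WeakDual ℝ X)))) : S = ⊤ := by
  by_contra hne
  obtain ⟨ψ, hψ⟩ : ∃ ψ, ψ ∉ S := by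
    by_contra! h
    exact hne (Submodule.eq_top_iff'.2 h)
  have : LocallyConvexSpace ℝ (WeakDual ℝ X) :=
    inferInstanceAs (LocallyConvexSpace ℝ (WeakBilin (topDualPairing ℝ X)))
  obtain ⟨F, u, hFS, hFψ⟩ := geometric_hahn_banach_closed_point S.convex hS hψ
  obtain ⟨x, hx⟩ := LinearMap.dualEmbedding_surjective (topDualPairing ℝ X) F
  have hFx : ∀ φ : WeakDual ℝ X, F φ = φ x := fun φ => by rw [← hx]; rfl
  have hu : 0 < u := by simpa using hFS 0 S.zero_mem
  have hzero : ∀ φ ∈ S, φ x = 0 := by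
    intro φ hφ
    by_contra hne
    have h := hFS _ (S.smul_mem (u / φ x) hφ)
    rw [map_smul, hFx, smul_eq_mul, div_mul_cancel₀ _ hne] at h
    exact lt_irrefl _ h
  have hx0 : x ≠ 0 := by
    rintro rfl
    rw [hFx, map_zero] at hFψ
    exact hu.not_gt hFψ
  obtain ⟨-, ⟨φ, hφ, rfl⟩, hφx⟩ := hT x hx0
  exact hφx (hzero φ hφ)

/-! ### Pettis integrability -/

/-- The functionals `φ` for which `⟨φ, f⟩` is integrable with indefinite integral `A ↦ φ (y A)`. -/
def integralSubspace {X Ω : Type*} [NormedAddCommGroup X] [NormedSpace ℝ X] [MeasurableSpace Ω]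
    (f : Ω → X) (ν : Measure Ω) (y : Set Ω → X) : Submodule ℝ (WeakDual ℝ X) where
  carrier := {φ | Integrable (fun ω => φ (f ω)) ν ∧
    ∀ A, MeasurableSet A → φ (y A) = ∫ ω in A, φ (f ω) ∂ν}
  zero_mem' := by
    have h0 : ∀ x : X, (0 : WeakDual ℝ X) x = 0 := fun _ => rfl
    simp [h0]
  add_mem' := by
    rintro φ ψ ⟨hφ, hφ'⟩ ⟨hψ, hψ'⟩
    refine ⟨hφ.add hψ, fun A hA => ?_⟩
    have hadd : ∀ x, (φ + ψ) x = φ x + ψ x := fun _ => rfl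
    simp only [hadd, integral_add hφ.integrableOn hψ.integrableOn, hφ' A hA, hψ' A hA]
  smul_mem' := by
    rintro c φ ⟨hφ, hφ'⟩
    refine ⟨hφ.const_mul c, fun A hA => ?_⟩
    have hsmul : ∀ x, (c • φ) x = c * φ x := fun _ => rfl
    simp only [hsmul, integral_const_mul, hφ' A hA]

theorem isSeqClosed_integralSubspace {X Ω : Type*} [NormedAddCommGroup X] [NormedSpace ℝ X]
    [MeasurableSpace Ω] (f : Ω → X) (ν : Measure Ω) [IsFiniteMeasure ν] (y : Set Ω → X) :
    IsSeqClosed (integralSubspace f ν y : Set (WeakDual ℝ X)) := by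
  intro φ φ₀ hφ hlim
  have hpt : ∀ x, Tendsto (fun n => φ n x) atTop (𝓝 (φ₀ x)) := fun x =>
    ((WeakDual.eval_continuous x).tendsto φ₀).comp hlim
  have hA : ∀ A, MeasurableSet A →
      Tendsto (fun n => ∫ ω in A, φ n (f ω) ∂ν) atTop (𝓝 (φ₀ (y A))) := fun A hA =>
    (hpt (y A)).congr fun n => (hφ n).2 A hA
  obtain ⟨h1, h2⟩ := integrable_and_tendsto_setIntegral_of_cauchySeq (fun n => (hφ n).1)
    (fun A hA' => (hA A hA').cauchySeq) (Eventually.of_forall fun ω => hpt (f ω))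
  exact ⟨h1, fun A hA' => tendsto_nhds_unique (hA A hA') (h2 A)⟩

theorem mainTheorem2 {Ω X : Type*} [MeasurableSpace Ω] (ν : Measure Ω) [IsProbabilityMeasure ν]
    [ν.IsComplete] [NormedAddCommGroup X] [NormedSpace ℝ X] [CompleteSpace X]
    (hX : PropertyDPrime X) (Γ : Submodule ℝ (StrongDual ℝ X))
    (hΓ : IsTotalSet (Γ : Set (StrongDual ℝ X)))
    (f : Ω → X) (hf : IsGammaIntegrable Γ f ν) : IsPettisIntegrable f ν := by
  obtain ⟨hint, hex⟩ := hf
  choose! y hy using hex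
  have hΓS : ∀ φ ∈ Γ, StrongDual.toWeakDual φ ∈ integralSubspace f ν y := fun φ hφ =>
    ⟨hint φ hφ, fun A hA => hy A hA φ hφ⟩
  have htop : integralSubspace f ν y = ⊤ :=
    WeakDual.eq_top_of_isClosed_of_isTotalSet (hX _ (isSeqClosed_integralSubspace f ν y))
      fun x hx =>
        let ⟨φ, hφ, hφx⟩ := hΓ x hx
        ⟨φ, ⟨StrongDual.toWeakDual φ, hΓS φ hφ, rfl⟩, hφx⟩
  have hall : ∀ φ : StrongDual ℝ X, StrongDual.toWeakDual φ ∈ integralSubspace f ν y :=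
    fun φ => htop ▸ Submodule.mem_top
  exact ⟨fun φ _ => (hall φ).1, fun A hA => ⟨y A, fun φ _ => (hall φ).2 A hA⟩⟩
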